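/- **Setting.** Let $\mathcal W$ be the set of nondecreasing continuous functions $\omega:[0,\infty)\to[0,\infty)$ with $\omega(0)=0$, $\omega(x+y)\le\omega(x)+\omega(y)$ for all $x,y\ge 0$, $\int_1^\infty \omega(t)t^{-2}\,dt<\infty$ and $\lim_{t\to\infty}\omega(t)/\log(1+t)=\infty$. Fix $\omega\in\mathcal W$ and an open set $\Omega\subseteq\mathbb R^d$. For $l>0$ put $\|f\|_{l}=\int_{\mathbb R^d}|\hat f(\xi)|e^{l\omega(|\xi|)}\,d\xi$. * $\mathcal D^{(\omega)}(\Omega)$ is the space of continuous $f:\mathbb R^d\to\mathbb C$ with compact support contained in $\Omega$ and $\|f\|_l<\infty$ for all $l>0$ (such $f$ are automatically smooth). * $\mathcal E^{(\omega)}(\Omega)$ is the space of smooth $f:\Omega\to\mathbb C$ such that $\varphi f\in\mathcal D^{(\omega)}(\Omega)$ for all $\varphi\in\mathcal D^{(\omega)}(\Omega)$. For $K\subset\Omega$ compact and $h>0$, $\|f\|_{K,h}$ is the infimum of $\|\varphi f\|_h$ over all $\varphi\in\mathcal D^{(\omega)}(\Omega)$ with $\varphi=1$ on $K$. * All nets $(g_\varepsilon)$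 are indexed by $\varepsilon\in(0,1)$, and $o(\cdot)$ refers to $\varepsilon\to0^+$. A net $(g_\varepsilon)$ in $\mathcal E^{(\omega)}(\Omega)$ is *moderate* if for all compact $K\subset\Omega$ and all $h>0$ there is $k>0$ with $\|g_\varepsilon\|_{K,h}=o(e^{k\omega(1/\varepsilon)})$; it is *negligible* if for all compact $K\subset\Omega$, all $h>0$ and all $k>0$, $\|g_\varepsilon\|_{K,h}=o(e^{-k\omega(1/\varepsilon)})$; it is *regular* if it is moderate and for all compact $K\subset\Omega$ there is $k>0$ such that for all $h>0$, $\|g_\varepsilon\|_{K,h}=o(e^{k\omega(1/\varepsilon)})$. * $\mathcal G^{(\omega)}(\Omega)$ is the quotient of the space of moderate nets by the space of negligible nets, $[(g_\varepsilon)]$ is the class of $(g_\varepsilon)$, and $\mathcal G^{(\omega),\infty}(\Omega)$ is the set of those classes that have a regular representative. * A net $(c_\varepsilon)$ of complex numbers is *negligible* if $|c_\varepsilon|=o(e^{-k\omega(1/\varepsilon)})$ for all $k>0$. Finally $\langle f,\rho\rangle=\int_\Omega f\rho\,dx$. **Theorem.** Let $g\in\mathcal G^{(\omega),\infty}(\Omega)$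 and let $(g_\varepsilon)$ be a moderate net with $g=[(g_\varepsilon)]$. If for every $\rho\in\mathcal D^{(\omega)}(\Omega)$ the net of complex numbers $(\langle g_\varepsilon,\rho\rangle)$ is negligible, then $g=0$ in $\mathcal G^{(\omega)}(\Omega)$. -/

import Mathlib

open MeasureTheory Filter Set
open scoped ENNReal Topology FourierTransform

noncomputable section

namespace BeurlingBjork

/-- The class `𝓦` of weight functions on `[0, ∞)`; a weight is represented by a function `ℝ → ℝ`,
of which only the values on `[0, ∞)` matter. -/
structure IsWeight (ω : ℝ → ℝ) : Prop where
  continuousOn : ContinuousOn ω (Ici 0)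
  monotoneOn : MonotoneOn ω (Ici 0)
  nonneg : ∀ t, 0 ≤ t → 0 ≤ ω t
  map_zero : ω 0 = 0
  subadditive : ∀ x y, 0 ≤ x → 0 ≤ y → ω (x + y) ≤ ω x + ω y
  integrable : IntegrableOn (fun t => ω t / t ^ 2) (Ioi 1)
  log_growth : Tendsto (fun t => ω t / Real.log (1 + t)) atTop atTop

variable {d : ℕ}

/-- The norm `‖f‖_l^ω = ∫ |f̂(ξ)| e^{l ω(|ξ|)} dξ`, with values in `[0, ∞]`. -/
def fourierNorm (ω : ℝ → ℝ) (l : ℝ) (f : EuclideanSpace ℝ (Fin d) → ℂ) : ℝ≥0∞ :=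
  ∫⁻ ξ, ‖𝓕 f ξ‖ₑ * ENNReal.ofReal (Real.exp (l * ω ‖ξ‖))

/-- The Beurling test functions `𝓓^(ω)(Ω)`: functions with compact support in `Ω` all of whose
norms `‖f‖_l^ω`, `l > 0`, are finite. Continuity only selects the representative for which the
Fourier transform determines `f`; since `ω` dominates `log (1 + t)`, such an `f` is smooth. -/
def testFun (ω : ℝ → ℝ) (Ω : TopologicalSpace.Opens (EuclideanSpace ℝ (Fin d))) :
    Set (EuclideanSpace ℝ (Fin d) → ℂ) :=
  {f | Continuous f ∧ HasCompactSupport f ∧ tsupport f ⊆ Ω ∧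
    ∀ l : ℝ, 0 < l → fourierNorm ω l f < ∞}

/-- Extension by zero of a function on `Ω` to the whole space. -/
def zeroExt (Ω : TopologicalSpace.Opens (EuclideanSpace ℝ (Fin d))) (f : Ω → ℂ) :
    EuclideanSpace ℝ (Fin d) → ℂ :=
  Function.extend Subtype.val f 0

/-- The Beurling ultradifferentiable functions `𝓔^(ω)(Ω)`: smooth functions on `Ω` whose product
with every test function is a test function. -/
def ultraDiff (ω : ℝ → ℝ) (Ω : TopologicalSpace.Opens (EuclideanSpace ℝ (Fin d))) :
    Set (Ω → ℂ) :=
  {f | ContDiffOn ℝ ((⊤ : ℕ∞) : WithTop ℕ∞) (zeroExt Ω f) Ω ∧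
    ∀ φ ∈ testFun ω Ω, (fun x => φ x * zeroExt Ω f x) ∈ testFun ω Ω}

/-- The local norm `‖f‖_{K,l}^ω`: the infimum of `‖φ f‖_l^ω` over all test functions `φ` that are
equal to `1` on `K`. -/
def localNorm (ω : ℝ → ℝ) (Ω : TopologicalSpace.Opens (EuclideanSpace ℝ (Fin d)))
    (K : Set (EuclideanSpace ℝ (Fin d))) (l : ℝ) (f : Ω → ℂ) : ℝ≥0∞ :=
  ⨅ φ ∈ {φ | φ ∈ testFun ω Ω ∧ ∀ x ∈ K, φ x = 1},
    fourierNorm ω l (fun x => φ x * zeroExt Ω f x)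

/-- Nets `(g_ε)`, `ε ∈ (0, 1)`, of functions on `Ω`. -/
abbrev Net (Ω : TopologicalSpace.Opens (EuclideanSpace ℝ (Fin d))) : Type :=
  Ioo (0 : ℝ) 1 → Ω → ℂ

/-- The filter `ε → 0⁺` on `(0, 1)`. -/
def epsZero : Filter (Ioo (0 : ℝ) 1) :=
  comap (fun ε => (ε : ℝ)) (𝓝[>] 0)

/-- `N_ε = o(e^{k ω(1/ε)})` as `ε → 0⁺`, for a net of elements of `[0, ∞]`; `k` may be negative. -/
def IsLittleOExp (ω : ℝ → ℝ) (k : ℝ) (N : Ioo (0 : ℝ) 1 → ℝ≥0∞) : Prop :=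
  Tendsto (fun ε => N ε * ENNReal.ofReal (Real.exp (-(k * ω (1 / (ε : ℝ)))))) epsZero (𝓝 0)

/-- The moderate nets `𝓔^(ω)_M(Ω)`. -/
def moderateNets (ω : ℝ → ℝ) (Ω : TopologicalSpace.Opens (EuclideanSpace ℝ (Fin d))) :
    Set (Net Ω) :=
  {g | (∀ ε, g ε ∈ ultraDiff ω Ω) ∧
    ∀ K : Set (EuclideanSpace ℝ (Fin d)), IsCompact K → K ⊆ Ω →
      ∀ h : ℝ, 0 < h → ∃ k : ℝ, 0 < k ∧
        IsLittleOExp ω k (fun ε => localNorm ω Ω K h (g ε))}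

/-- The negligible nets `𝓝^(ω)(Ω)`. -/
def negligibleNets (ω : ℝ → ℝ) (Ω : TopologicalSpace.Opens (EuclideanSpace ℝ (Fin d))) :
    Set (Net Ω) :=
  {g | (∀ ε, g ε ∈ ultraDiff ω Ω) ∧
    ∀ K : Set (EuclideanSpace ℝ (Fin d)), IsCompact K → K ⊆ Ω →
      ∀ h : ℝ, 0 < h → ∀ k : ℝ, 0 < k →
        IsLittleOExp ω (-k) (fun ε => localNorm ω Ω K h (g ε))}

/-- The regular nets `𝓔^(ω),∞(Ω)`: the growth exponent `k` depends on `K` only. -/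
def regularNets (ω : ℝ → ℝ) (Ω : TopologicalSpace.Opens (EuclideanSpace ℝ (Fin d))) :
    Set (Net Ω) :=
  {g | g ∈ moderateNets ω Ω ∧
    ∀ K : Set (EuclideanSpace ℝ (Fin d)), IsCompact K → K ⊆ Ω →
      ∃ k : ℝ, 0 < k ∧ ∀ h : ℝ, 0 < h →
        IsLittleOExp ω k (fun ε => localNorm ω Ω K h (g ε))}

/-- The class `[(g_ε)]`: the coset of `(g_ε)` modulo negligible nets, as a set of moderate nets. -/
def genClass (ω : ℝ → ℝ) (Ω : TopologicalSpace.Opens (EuclideanSpace ℝ (Fin d))) (g : Net Ω) :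
    Set (Net Ω) :=
  {u | u ∈ moderateNets ω Ω ∧ u - g ∈ negligibleNets ω Ω}

/-- The factor space `𝓖^(ω)(Ω) = 𝓔^(ω)_M(Ω) / 𝓝^(ω)(Ω)`, as the set of all cosets. -/
def genFun (ω : ℝ → ℝ) (Ω : TopologicalSpace.Opens (EuclideanSpace ℝ (Fin d))) :
    Set (Set (Net Ω)) :=
  genClass ω Ω '' moderateNets ω Ω

/-- The Beurling-regular generalized functions `𝓖^(ω),∞(Ω)`: the elements of `𝓖^(ω)(Ω)` that have
a regular representative. -/
def regularGenFun (ω : ℝ → ℝ) (Ω : TopologicalSpace.Opens (EuclideanSpace ℝ (Fin d))) :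
    Set (Set (Net Ω)) :=
  {g | g ∈ genFun ω Ω ∧ ∃ u ∈ g, u ∈ regularNets ω Ω}

/-- The bilinear pairing `⟨f, ρ⟩ = ∫_Ω f ρ dx`. -/
def pairing (Ω : TopologicalSpace.Opens (EuclideanSpace ℝ (Fin d))) (f : Ω → ℂ)
    (ρ : EuclideanSpace ℝ (Fin d) → ℂ) : ℂ :=
  ∫ x in (Ω : Set (EuclideanSpace ℝ (Fin d))), zeroExt Ω f x * ρ x

/-- The negligible nets of complex numbers: `c_ε = o(e^{-k ω(1/ε)})` for all `k > 0`. -/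
def negligibleConst (ω : ℝ → ℝ) : Set (Ioo (0 : ℝ) 1 → ℂ) :=
  {c | ∀ k : ℝ, 0 < k → IsLittleOExp ω (-k) (fun ε => ‖c ε‖ₑ)}

end BeurlingBjork

end

open MeasureTheory Filter Set
open scoped ENNReal Topology FourierTransform

noncomputable section
namespace BeurlingBjork
variable {d : ℕ}
variable {ω : ℝ → ℝ} {Ω : TopologicalSpace.Opens (EuclideanSpace ℝ (Fin d))}
-- Negligible nets pair negligibly with test functions, so the hypothesis passes from `gε` to a
-- regular representative `u`, and it suffices to show that `u` is negligible. Fix a cutoff `φ` and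
-- write `V_ε` for the Fourier transform of `φ u_ε`. Multiplying `φ` by a series of characters with
-- arbitrary frequencies `ξ_j` and rapidly decreasing coefficients gives a test function, and its
-- pairing with `u_ε` is a series in the values `V_ε(ξ_j)`. Banach–Steinhaus on bounded sequences
-- turns the smallness of each such pairing into a uniform estimate: for every `K` there is `n` with
-- `e^{K ω(1/ε)} |V_ε(ξ)| ≤ n 2^n e^{n ω(|ξ|)}` for all `ξ` and all small `ε`
-- (`exists_norm_fourier_le`). This settles the low frequencies `M ω(|ξ|) ≤ ω(1/ε)`. On the others a
-- large weight in `ξ` dominates any power of `e^{ω(1/ε)}`, and regularity bounds the norm with that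
-- larger weight at no cost in the growth exponent (`interpolation_le`, `isLittleOExp_of_regular`).
open Real in
/-- The superposition `x ↦ ∫ e^{-2πi⟨ξ a, x⟩} m(a) dν(a)` of characters. -/
def superposition {α : Type*} [MeasurableSpace α] (ν : Measure α)
    (ξ : α → EuclideanSpace ℝ (Fin d)) (m : α → ℂ) (x : EuclideanSpace ℝ (Fin d)) : ℂ :=
  ∫ a, fourierChar (-inner ℝ (ξ a) x) • m a ∂ν

/-! ### Fourier transforms of products with superpositions of characters -/

section Superposition

variable {α : Type*} [MeasurableSpace α] {ν : Measure α}
  {ξ : α → EuclideanSpace ℝ (Fin d)} {m : α → ℂ}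

theorem continuous_superposition (hξ : Measurable ξ) (hm : Integrable m ν) :
    Continuous (superposition ν ξ m) := by
  refine continuous_of_dominated (bound := fun a => ‖m a‖) ?_ ?_ hm.norm ?_
  · intro x
    have : Measurable fun a => -inner ℝ (ξ a) x := by fun_prop
    exact (Real.continuous_fourierChar.comp_stronglyMeasurable
      this.stronglyMeasurable).aestronglyMeasurable.smul
      hm.aestronglyMeasurable
  · exact fun x => Eventually.of_forall fun a => by simp
  · refine Eventually.of_forall fun a => ?_
    exact (Real.continuous_fourierChar.comp (by fun_prop)).smul continuous_const

/-- Multiplication by a character translates the Fourier transform; Fubini sums the translates. -/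
theorem fourier_mul_superposition [SFinite ν] (hξ : Measurable ξ) (hm : Integrable m ν)
    {f : EuclideanSpace ℝ (Fin d) → ℂ} (hf : Integrable f) (ζ : EuclideanSpace ℝ (Fin d)) :
    𝓕 (fun x => f x * superposition ν ξ m x) ζ = ∫ a, m a * 𝓕 f (ζ + ξ a) ∂ν := by
  have h1 : Measurable fun p : EuclideanSpace ℝ (Fin d) × α => -inner ℝ p.1 ζ := by fun_prop
  have h2 : Measurable fun p : EuclideanSpace ℝ (Fin d) × α => -inner ℝ (ξ p.2) p.1 := by
    fun_prop
  have hint : Integrable (Function.uncurry fun (x : EuclideanSpace ℝ (Fin d)) (a : α) =>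
      Real.fourierChar (-inner ℝ x ζ) • (f x * Real.fourierChar (-inner ℝ (ξ a) x) • m a))
      (volume.prod ν) := by
    refine (hf.mul_prod hm).mono ?_ (Eventually.of_forall fun p => by
      simp [Function.uncurry])
    exact (Real.continuous_fourierChar.comp_stronglyMeasurable
      h1.stronglyMeasurable).aestronglyMeasurable.smul
        (hf.aestronglyMeasurable.comp_fst.mul ((Real.continuous_fourierChar.comp_stronglyMeasurable
          h2.stronglyMeasurable).aestronglyMeasurable.smul hm.aestronglyMeasurable.comp_snd))
  simp only [Circle.smul_def, smul_eq_mul] at hint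
  simp only [Real.fourier_eq, superposition, Circle.smul_def, smul_eq_mul, ← integral_const_mul]
  rw [integral_integral_swap hint]
  refine integral_congr_ae (Eventually.of_forall fun a => integral_congr_ae
    (Eventually.of_forall fun x => ?_))
  simp only [inner_add_right, neg_add, AddChar.map_add_eq_mul, Circle.coe_mul,
    real_inner_comm]
  ring

theorem integral_mul_superposition [SFinite ν] (hξ : Measurable ξ) (hm : Integrable m ν)
    {f : EuclideanSpace ℝ (Fin d) → ℂ} (hf : Integrable f) :
    ∫ x, f x * superposition ν ξ m x = ∫ a, m a * 𝓕 f (ξ a) ∂ν := by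
  have := fourier_mul_superposition hξ hm hf 0
  simpa [Real.fourier_eq (fun x => f x * superposition ν ξ m x)] using this

end Superposition

theorem continuous_fourier {f : EuclideanSpace ℝ (Fin d) → ℂ} (hf : Integrable f) :
    Continuous (𝓕 f) :=
  VectorFourier.fourierIntegral_continuous Real.continuous_fourierChar
    (innerSL ℝ).continuous₂ hf

/-- Fourier inversion, the frequency map `η ↦ -η` correcting the sign of the character. It lets
products of test functions be treated like products with character series. -/
theorem superposition_fourier {f : EuclideanSpace ℝ (Fin d) → ℂ} (hc : Continuous f)
    (hf : Integrable f) (hf' : Integrable (𝓕 f)) :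
    superposition volume (fun η => -η) (𝓕 f) = f := by
  conv_rhs => rw [← hc.fourierInv_fourier_eq hf hf']
  ext x
  simp [superposition, Real.fourierInv_eq]

/-! ### Submultiplicativity of the exponential weights -/

namespace IsWeight


theorem continuous_norm (hω : IsWeight ω) :
    Continuous fun ξ : EuclideanSpace ℝ (Fin d) => ω ‖ξ‖ :=
  hω.continuousOn.comp_continuous _root_.continuous_norm fun ξ => norm_nonneg ξ

theorem nonneg_norm (hω : IsWeight ω) (ξ : EuclideanSpace ℝ (Fin d)) : 0 ≤ ω ‖ξ‖ :=
  hω.nonneg _ (norm_nonneg ξ)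

theorem norm_le_add (hω : IsWeight ω) (ζ ξ : EuclideanSpace ℝ (Fin d)) :
    ω ‖ζ‖ ≤ ω ‖ζ + ξ‖ + ω ‖ξ‖ := by
  refine le_trans (hω.monotoneOn (norm_nonneg _) (mem_Ici.2 (by positivity)) ?_)
    (hω.subadditive _ _ (norm_nonneg _) (norm_nonneg _))
  simpa using norm_sub_le (ζ + ξ) ξ

/-- Measurability of the weight `e^{l ω(|ξ|)}`, as an element of `[0, ∞]`. -/
theorem measurable_exp (hω : IsWeight ω) (l : ℝ) :
    Measurable fun ξ : EuclideanSpace ℝ (Fin d) => ENNReal.ofReal (Real.exp (l * ω ‖ξ‖)) :=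
  (Real.continuous_exp.comp (hω.continuous_norm.const_smul l)).measurable.ennreal_ofReal

theorem exp_le_mul (hω : IsWeight ω) {l : ℝ} (hl : 0 ≤ l) (ζ ξ : EuclideanSpace ℝ (Fin d)) :
    ENNReal.ofReal (Real.exp (l * ω ‖ζ‖)) ≤
      ENNReal.ofReal (Real.exp (l * ω ‖ζ + ξ‖)) * ENNReal.ofReal (Real.exp (l * ω ‖ξ‖)) := by
  rw [← ENNReal.ofReal_mul (Real.exp_pos _).le, ← Real.exp_add, ← mul_add]
  gcongr
  exact hω.norm_le_add ζ ξ

theorem one_le_exp (hω : IsWeight ω) {l : ℝ} (hl : 0 ≤ l) (ξ : EuclideanSpace ℝ (Fin d)) :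
    1 ≤ ENNReal.ofReal (Real.exp (l * ω ‖ξ‖)) := by
  rw [ENNReal.one_le_ofReal]
  exact Real.one_le_exp (mul_nonneg hl (hω.nonneg_norm ξ))

end IsWeight


/-- Subadditivity of `ω` splits the weight at `ζ` between `ζ + ξ a` and `ξ a`; Tonelli and
translation invariance then separate the factors. Lebesgue `ν` yields the algebra inequality
`fourierNorm_mul_le`, counting measure serves the character series. -/
theorem fourierNorm_mul_superposition_le (hω : IsWeight ω) {l : ℝ} (hl : 0 ≤ l)
    {α : Type*} [MeasurableSpace α] {ν : Measure α} [SFinite ν]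
    {ξ : α → EuclideanSpace ℝ (Fin d)} {m : α → ℂ} (hξ : Measurable ξ) (hm : Integrable m ν)
    {f : EuclideanSpace ℝ (Fin d) → ℂ} (hf : Integrable f) :
    fourierNorm ω l (fun x => f x * superposition ν ξ m x) ≤
      fourierNorm ω l f * ∫⁻ a, ‖m a‖ₑ * ENNReal.ofReal (Real.exp (l * ω ‖ξ a‖)) ∂ν := by
  set w : EuclideanSpace ℝ (Fin d) → ℝ≥0∞ := fun ζ => ENNReal.ofReal (Real.exp (l * ω ‖ζ‖))
  have hw : Measurable w := hω.measurable_exp l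
  have hF : Measurable fun ζ => ‖𝓕 f ζ‖ₑ := (continuous_fourier hf).measurable.enorm
  have hq : Measurable fun ζ => ‖𝓕 f ζ‖ₑ * w ζ := hF.mul hw
  calc fourierNorm ω l (fun x => f x * superposition ν ξ m x)
      ≤ ∫⁻ ζ, ∫⁻ a, (‖m a‖ₑ * w (ξ a)) * (‖𝓕 f (ζ + ξ a)‖ₑ * w (ζ + ξ a)) ∂ν := by
        refine lintegral_mono fun ζ => ?_
        rw [fourier_mul_superposition hξ hm hf]
        refine (mul_le_mul_left (enorm_integral_le_lintegral_enorm _) _).trans ?_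
        rw [← lintegral_mul_const']
        · refine lintegral_mono fun a => ?_
          rw [enorm_mul]
          calc _ ≤ ‖m a‖ₑ * ‖𝓕 f (ζ + ξ a)‖ₑ * (w (ζ + ξ a) * w (ξ a)) :=
                mul_le_mul_right (hω.exp_le_mul hl ζ (ξ a)) _
            _ = _ := by ring
        · exact ENNReal.ofReal_ne_top
    _ = ∫⁻ a, (‖m a‖ₑ * w (ξ a)) * fourierNorm ω l f ∂ν := by
        rw [lintegral_lintegral_swap]
        · refine lintegral_congr fun a => ?_
          rw [lintegral_const_mul _ (f := fun x => ‖𝓕 f (x + ξ a)‖ₑ * w (x + ξ a))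
            (hq.comp (measurable_add_const (ξ a)))]
          congr 1
          exact lintegral_add_right_eq_self (fun ζ => ‖𝓕 f ζ‖ₑ * w ζ) (ξ a)
        · exact (hm.aestronglyMeasurable.comp_snd.enorm.mul
            (hw.comp (hξ.comp measurable_snd)).aemeasurable).mul
              (hq.comp (measurable_fst.add (hξ.comp measurable_snd))).aemeasurable
    _ = _ := by
        rw [mul_comm, lintegral_mul_const'']
        exact hm.aestronglyMeasurable.enorm.mul (hw.comp hξ).aemeasurable

/-! ### Test functions -/

section TestFun

theorem integrable_of_mem_testFun {f : EuclideanSpace ℝ (Fin d) → ℂ} (hf : f ∈ testFun ω Ω) :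
    Integrable f :=
  hf.1.integrable_of_hasCompactSupport hf.2.1

theorem lintegral_fourier_le_fourierNorm (hω : IsWeight ω) {l : ℝ} (hl : 0 ≤ l)
    (f : EuclideanSpace ℝ (Fin d) → ℂ) : ∫⁻ ξ, ‖𝓕 f ξ‖ₑ ≤ fourierNorm ω l f :=
  lintegral_mono fun ξ => le_mul_of_one_le_right' (hω.one_le_exp hl ξ)

theorem integrable_fourier_of_mem_testFun (hω : IsWeight ω) {f : EuclideanSpace ℝ (Fin d) → ℂ}
    (hf : f ∈ testFun ω Ω) : Integrable (𝓕 f) :=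
  ⟨(continuous_fourier (integrable_of_mem_testFun hf)).aestronglyMeasurable,
    (lintegral_fourier_le_fourierNorm hω zero_le_one f).trans_lt (hf.2.2.2 1 one_pos)⟩

theorem fourierNorm_mul_le (hω : IsWeight ω) {l : ℝ} (hl : 0 ≤ l)
    {f g : EuclideanSpace ℝ (Fin d) → ℂ} (hf : Integrable f) (hg : g ∈ testFun ω Ω) :
    fourierNorm ω l (fun x => f x * g x) ≤ fourierNorm ω l f * fourierNorm ω l g := by
  have := fourierNorm_mul_superposition_le hω hl (ν := volume)
    (ξ := fun η : EuclideanSpace ℝ (Fin d) => -η) measurable_neg (integrable_fourier_of_mem_testFun hω hg) hf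
  rw [superposition_fourier hg.1 (integrable_of_mem_testFun hg) (integrable_fourier_of_mem_testFun hω hg)] at this
  simpa only [norm_neg] using! this

theorem enorm_le_fourierNorm (hω : IsWeight ω) {l : ℝ} (hl : 0 ≤ l)
    {f : EuclideanSpace ℝ (Fin d) → ℂ} (hf : f ∈ testFun ω Ω) (x : EuclideanSpace ℝ (Fin d)) :
    ‖f x‖ₑ ≤ fourierNorm ω l f := by
  conv_lhs => rw [← superposition_fourier hf.1 (integrable_of_mem_testFun hf) (integrable_fourier_of_mem_testFun hω hf)]
  refine (enorm_integral_le_lintegral_enorm _).trans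
    (le_trans (lintegral_mono fun ξ => ?_) (lintegral_fourier_le_fourierNorm hω hl f))
  simp [← ofReal_norm]

theorem fourier_sub {f g : EuclideanSpace ℝ (Fin d) → ℂ} (hf : Integrable f)
    (hg : Integrable g) (ξ : EuclideanSpace ℝ (Fin d)) :
    𝓕 (fun x => f x - g x) ξ = 𝓕 f ξ - 𝓕 g ξ := by
  simp only [Real.fourier_eq, smul_sub]
  exact integral_sub ((Real.fourierIntegral_convergent_iff ξ).2 hf)
    ((Real.fourierIntegral_convergent_iff ξ).2 hg)

theorem fourierNorm_sub_le (hω : IsWeight ω) (l : ℝ) {f g : EuclideanSpace ℝ (Fin d) → ℂ}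
    (hf : Integrable f) (hg : Integrable g) :
    fourierNorm ω l (fun x => f x - g x) ≤ fourierNorm ω l f + fourierNorm ω l g := by
  unfold fourierNorm
  rw [← lintegral_add_left (f := fun ξ => ‖𝓕 f ξ‖ₑ * ENNReal.ofReal (Real.exp (l * ω ‖ξ‖)))
    ((continuous_fourier hf).measurable.enorm.mul (hω.measurable_exp l))]
  refine lintegral_mono fun ξ => ?_
  rw [fourier_sub hf hg, ← add_mul]
  gcongr
  exact enorm_sub_le

theorem sub_mem_testFun (hω : IsWeight ω) {f g : EuclideanSpace ℝ (Fin d) → ℂ}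
    (hf : f ∈ testFun ω Ω) (hg : g ∈ testFun ω Ω) : (fun x => f x - g x) ∈ testFun ω Ω := by
  have hs : tsupport (fun x => f x - g x) ⊆ tsupport f ∪ tsupport g := tsupport_sub f g
  refine ⟨hf.1.sub hg.1, ?_, hs.trans (union_subset hf.2.2.1 hg.2.2.1), fun l hl => ?_⟩
  · exact (hf.2.1.isCompact.union hg.2.1.isCompact).of_isClosed_subset (isClosed_tsupport _) hs
  · exact (fourierNorm_sub_le hω l (integrable_of_mem_testFun hf)
      (integrable_of_mem_testFun hg)).trans_lt
      (ENNReal.add_lt_top.2 ⟨hf.2.2.2 l hl, hg.2.2.2 l hl⟩)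

end TestFun
-- Local norms and the pairing
section LocalNorm

theorem zeroExt_of_mem (f : Ω → ℂ) {x : EuclideanSpace ℝ (Fin d)} (hx : x ∈ Ω) :
    zeroExt Ω f x = f ⟨x, hx⟩ :=
  Subtype.val_injective.extend_apply f 0 (⟨x, hx⟩ : Ω)

theorem zeroExt_of_notMem (f : Ω → ℂ) {x : EuclideanSpace ℝ (Fin d)} (hx : x ∉ Ω) :
    zeroExt Ω f x = 0 :=
  Function.extend_apply' _ _ _ fun ⟨a, ha⟩ => hx (ha ▸ a.2)

theorem zeroExt_sub (f g : Ω → ℂ) (x : EuclideanSpace ℝ (Fin d)) :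
    zeroExt Ω (f - g) x = zeroExt Ω f x - zeroExt Ω g x := by
  by_cases hx : x ∈ Ω
  · simp [zeroExt_of_mem _ hx]
  · simp [zeroExt_of_notMem _ hx]

theorem sub_mem_ultraDiff (hω : IsWeight ω) {f g : Ω → ℂ} (hf : f ∈ ultraDiff ω Ω)
    (hg : g ∈ ultraDiff ω Ω) : f - g ∈ ultraDiff ω Ω := by
  refine ⟨(hf.1.sub hg.1).congr fun x _ => zeroExt_sub f g x, fun φ hφ => ?_⟩
  simp only [zeroExt_sub, mul_sub]
  exact sub_mem_testFun hω (hf.2 φ hφ) (hg.2 φ hφ)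

/-- Any `ψ` equal to `1` on the support of `φ` satisfies `φ f = φ (ψ f)`, so the algebra inequality
applies before taking the infimum over `ψ`. The summand `1` keeps the divisor nonzero. -/
theorem fourierNorm_mul_le_localNorm (hω : IsWeight ω) {l : ℝ} (hl : 0 < l)
    {φ : EuclideanSpace ℝ (Fin d) → ℂ} (hφ : φ ∈ testFun ω Ω) {f : Ω → ℂ}
    (hf : f ∈ ultraDiff ω Ω) :
    fourierNorm ω l (fun x => φ x * zeroExt Ω f x) ≤
      (fourierNorm ω l φ + 1) * localNorm ω Ω (tsupport φ) l f := by
  have h : fourierNorm ω l (fun x => φ x * zeroExt Ω f x) / (fourierNorm ω l φ + 1) ≤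
      localNorm ω Ω (tsupport φ) l f := by
    refine le_iInf₂ fun ψ hψ => ENNReal.div_le_of_le_mul' ?_
    have hmul : (fun x => φ x * zeroExt Ω f x) = fun x => φ x * (ψ x * zeroExt Ω f x) := by
      ext x
      by_cases hx : x ∈ tsupport φ
      · simp [hψ.2 x hx]
      · simp [image_eq_zero_of_notMem_tsupport hx]
    rw [hmul]
    refine (fourierNorm_mul_le hω hl.le (integrable_of_mem_testFun hφ) (hf.2 ψ hψ.1)).trans ?_
    gcongr
    exact le_self_add
  rw [mul_comm]
  exact (ENNReal.div_le_iff_le_mul (Or.inl (by simp))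
    (Or.inl (by simp [(hφ.2.2.2 l hl).ne]))).1 h

theorem localNorm_le {φ : EuclideanSpace ℝ (Fin d) → ℂ} (hφ : φ ∈ testFun ω Ω)
    {K : Set (EuclideanSpace ℝ (Fin d))} (hK : ∀ x ∈ K, φ x = 1) (l : ℝ) (f : Ω → ℂ) :
    localNorm ω Ω K l f ≤ fourierNorm ω l (fun x => φ x * zeroExt Ω f x) :=
  iInf₂_le φ ⟨hφ, hK⟩

theorem pairing_eq (f : Ω → ℂ) (ρ : EuclideanSpace ℝ (Fin d) → ℂ) :
    pairing Ω f ρ = ∫ x, ρ x * zeroExt Ω f x := by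
  rw [pairing, setIntegral_eq_integral_of_forall_compl_eq_zero]
  · simp only [mul_comm]
  · intro x hx
    rw [zeroExt_of_notMem f hx, zero_mul]

theorem enorm_pairing_le (hω : IsWeight ω) {ρ : EuclideanSpace ℝ (Fin d) → ℂ}
    (hρ : ρ ∈ testFun ω Ω) {f : Ω → ℂ} (hf : f ∈ ultraDiff ω Ω) :
    ‖pairing Ω f ρ‖ₑ ≤ volume (tsupport ρ) * fourierNorm ω 1 (fun x => ρ x * zeroExt Ω f x) := by
  rw [pairing_eq, ← setIntegral_eq_integral_of_forall_compl_eq_zero (s := tsupport ρ)]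
  · refine (enorm_integral_le_lintegral_enorm _).trans ?_
    refine (lintegral_mono fun x =>
      enorm_le_fourierNorm hω zero_le_one (hf.2 ρ hρ) x).trans_eq ?_
    rw [setLIntegral_const, mul_comm]
  · intro x hx
    rw [image_eq_zero_of_notMem_tsupport hx, zero_mul]

theorem pairing_sub {ρ : EuclideanSpace ℝ (Fin d) → ℂ} (hρ : ρ ∈ testFun ω Ω) {f g : Ω → ℂ}
    (hf : f ∈ ultraDiff ω Ω) (hg : g ∈ ultraDiff ω Ω) :
    pairing Ω (f - g) ρ = pairing Ω f ρ - pairing Ω g ρ := by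
  simp only [pairing_eq, zeroExt_sub, mul_sub]
  exact integral_sub (integrable_of_mem_testFun (hf.2 ρ hρ))
    (integrable_of_mem_testFun (hg.2 ρ hρ))

end LocalNorm

/-! ### Asymptotics of nets -/

section Nets

instance epsZero_neBot : epsZero.NeBot :=
  comap_coe_neBot_of_le_principal (le_principal_iff.2 (Ioo_mem_nhdsGT one_pos))

theorem eventually_lt_epsZero {δ : ℝ} (hδ : 0 < δ) : ∀ᶠ ε : Ioo (0 : ℝ) 1 in epsZero, (ε : ℝ) < δ :=
  tendsto_comap.eventually (eventually_nhdsWithin_of_eventually_nhds (eventually_lt_nhds hδ))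

theorem tendsto_one_div_epsZero :
    Tendsto (fun ε : Ioo (0 : ℝ) 1 => 1 / (ε : ℝ)) epsZero atTop := by
  simp only [one_div]
  exact tendsto_inv_nhdsGT_zero.comp tendsto_comap

theorem IsWeight.eventually_log_le (hω : IsWeight ω) :
    ∀ᶠ t in atTop, Real.log (1 + t) ≤ ω t := by
  filter_upwards [hω.log_growth.eventually_ge_atTop 1, eventually_gt_atTop 0] with t h ht
  rwa [one_le_div (Real.log_pos (by linarith))] at h

theorem IsWeight.tendsto_atTop (hω : IsWeight ω) : Tendsto ω atTop atTop :=
  tendsto_atTop_mono' _ hω.eventually_log_le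
    (Real.tendsto_log_atTop.comp (tendsto_atTop_add_const_left _ 1 tendsto_id))

theorem IsLittleOExp.of_le_const_mul {k : ℝ} {N N' : Ioo (0 : ℝ) 1 → ℝ≥0∞}
    (h : IsLittleOExp ω k N') {C : ℝ≥0∞} (hC : C ≠ ∞) (hN : ∀ ε, N ε ≤ C * N' ε) :
    IsLittleOExp ω k N := by
  have h' := ENNReal.Tendsto.const_mul (a := C) h (Or.inr hC)
  rw [mul_zero] at h'
  refine tendsto_of_tendsto_of_tendsto_of_le_of_le tendsto_const_nhds h' (fun _ => zero_le)
    fun ε => ?_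
  rw [← mul_assoc]
  exact mul_le_mul_left (hN ε) _

theorem IsLittleOExp.add {k : ℝ} {N N' : Ioo (0 : ℝ) 1 → ℝ≥0∞}
    (h : IsLittleOExp ω k N) (h' : IsLittleOExp ω k N') :
    IsLittleOExp ω k (fun ε => N ε + N' ε) := by
  simpa only [IsLittleOExp, add_mul, add_zero] using Tendsto.add h h'

/-- Without a cutoff the local norm would be an infimum over the empty set, hence `∞`, which
moderateness rules out. -/
theorem exists_cutoff {u : Net Ω} (hu : u ∈ moderateNets ω Ω)
    {K : Set (EuclideanSpace ℝ (Fin d))} (hK : IsCompact K) (hKΩ : K ⊆ Ω) :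
    ∃ φ ∈ testFun ω Ω, ∀ x ∈ K, φ x = 1 := by
  obtain ⟨k, -, hk⟩ := hu.2 K hK hKΩ 1 one_pos
  obtain ⟨ε, hε⟩ := (hk.eventually_lt_const one_pos).exists
  by_contra! hne
  have : localNorm ω Ω K 1 (u ε) = ∞ := by
    refine iInf₂_eq_top.2 fun φ hφ => ?_
    obtain ⟨x, hx, hne⟩ := hne φ hφ.1
    exact absurd (hφ.2 x hx) hne
  dsimp only at hε
  rw [this, ENNReal.top_mul (by simp [Real.exp_pos])] at hε
  exact not_top_lt hε

theorem fourierNorm_isLittleOExp (hω : IsWeight ω) {φ : EuclideanSpace ℝ (Fin d) → ℂ}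
    (hφ : φ ∈ testFun ω Ω) {u : Net Ω} (hu : ∀ ε, u ε ∈ ultraDiff ω Ω) {h k : ℝ} (hh : 0 < h)
    (hloc : IsLittleOExp ω k fun ε => localNorm ω Ω (tsupport φ) h (u ε)) :
    IsLittleOExp ω k fun ε => fourierNorm ω h (fun x => φ x * zeroExt Ω (u ε) x) :=
  hloc.of_le_const_mul (by simp [(hφ.2.2.2 h hh).ne]) fun ε =>
    fourierNorm_mul_le_localNorm hω hh hφ (hu ε)

theorem localNorm_isLittleOExp {φ : EuclideanSpace ℝ (Fin d) → ℂ}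
    (hφ : φ ∈ testFun ω Ω) {K : Set (EuclideanSpace ℝ (Fin d))} (hK : ∀ x ∈ K, φ x = 1)
    {u : Net Ω} {h k : ℝ}
    (hF : IsLittleOExp ω k fun ε => fourierNorm ω h (fun x => φ x * zeroExt Ω (u ε) x)) :
    IsLittleOExp ω k fun ε => localNorm ω Ω K h (u ε) :=
  hF.of_le_const_mul ENNReal.one_ne_top fun ε => by
    rw [one_mul]; exact localNorm_le hφ hK h (u ε)

theorem moderateNets_of_negligibleNets {u : Net Ω} (hu : u ∈ negligibleNets ω Ω)
    (hω : IsWeight ω) : u ∈ moderateNets ω Ω := by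
  refine ⟨hu.1, fun K hK hKΩ h hh => ⟨1, one_pos, ?_⟩⟩
  refine tendsto_of_tendsto_of_tendsto_of_le_of_le tendsto_const_nhds
    (hu.2 K hK hKΩ h hh 1 one_pos) (fun _ => zero_le) fun ε => ?_
  have : 0 ≤ ω (1 / (ε : ℝ)) := hω.nonneg _ (one_div_nonneg.2 ε.2.1.le)
  dsimp only
  gcongr
  linarith

theorem sub_mem_negligibleNets (hω : IsWeight ω) {u v : Net Ω} (hu : u ∈ negligibleNets ω Ω)
    (hv : v ∈ negligibleNets ω Ω) : u - v ∈ negligibleNets ω Ω := by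
  refine ⟨fun ε => sub_mem_ultraDiff hω (hu.1 ε) (hv.1 ε), fun K hK hKΩ h hh k hk => ?_⟩
  obtain ⟨φ, hφ, hφK⟩ := exists_cutoff (moderateNets_of_negligibleNets hu hω) hK hKΩ
  refine localNorm_isLittleOExp hφ hφK (IsLittleOExp.of_le_const_mul
    ((fourierNorm_isLittleOExp hω hφ hu.1 hh (hu.2 _ hφ.2.1 hφ.2.2.1 h hh k hk)).add
      (fourierNorm_isLittleOExp hω hφ hv.1 hh (hv.2 _ hφ.2.1 hφ.2.2.1 h hh k hk)))
    ENNReal.one_ne_top fun ε => ?_)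
  simp only [one_mul, Pi.sub_apply, zeroExt_sub, mul_sub]
  exact fourierNorm_sub_le hω h (integrable_of_mem_testFun ((hu.1 ε).2 φ hφ))
    (integrable_of_mem_testFun ((hv.1 ε).2 φ hφ))

theorem pairing_mem_negligibleConst (hω : IsWeight ω) {u : Net Ω} (hu : u ∈ negligibleNets ω Ω)
    {ρ : EuclideanSpace ℝ (Fin d) → ℂ} (hρ : ρ ∈ testFun ω Ω) :
    (fun ε => pairing Ω (u ε) ρ) ∈ negligibleConst ω := fun k hk =>
  (fourierNorm_isLittleOExp hω hρ hu.1 one_pos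
    (hu.2 _ hρ.2.1 hρ.2.2.1 1 one_pos k hk)).of_le_const_mul hρ.2.1.isCompact.measure_ne_top
    fun ε => enorm_pairing_le hω hρ (hu.1 ε)

theorem sub_mem_negligibleConst {a b : Ioo (0 : ℝ) 1 → ℂ} (ha : a ∈ negligibleConst ω)
    (hb : b ∈ negligibleConst ω) : (fun ε => a ε - b ε) ∈ negligibleConst ω := fun k hk =>
  ((ha k hk).add (hb k hk)).of_le_const_mul ENNReal.one_ne_top fun ε => by
    rw [one_mul]; exact enorm_sub_le

end Nets
-- Uniform Fourier estimate from Banach–Steinhaus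
section UniformBoundedness

/-- The functional `b ↦ ∑ b_j a_j` on the bounded sequences given by a summable sequence `a`. -/
def seqFunctional (a : ℕ → ℂ) (ha : Integrable a Measure.count) :
    BoundedContinuousFunction ℕ ℂ →L[ℂ] ℂ :=
  have hint (b : BoundedContinuousFunction ℕ ℂ) :
      Integrable (fun j => b j * a j) Measure.count :=
    ha.bdd_mul (c := ‖b‖) b.continuous.aestronglyMeasurable
      (Eventually.of_forall b.norm_coe_le_norm)
  LinearMap.mkContinuous
    { toFun := fun b => ∫ j, b j * a j ∂Measure.count
      map_add' := fun b c => by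
        simp only [BoundedContinuousFunction.add_apply, add_mul]
        exact integral_add (hint b) (hint c)
      map_smul' := fun r b => by
        simp only [BoundedContinuousFunction.smul_apply, smul_eq_mul, mul_assoc,
          integral_const_mul, RingHom.id_apply] }
    (∫ j, ‖a j‖ ∂Measure.count) fun b => by
      rw [mul_comm, ← integral_const_mul]
      refine norm_integral_le_of_norm_le (ha.norm.const_mul _) (Eventually.of_forall fun j => ?_)
      rw [norm_mul]
      gcongr
      exact b.norm_coe_le_norm j

theorem seqFunctional_apply (a : ℕ → ℂ) (ha : Integrable a Measure.count)
    (b : BoundedContinuousFunction ℕ ℂ) :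
    seqFunctional a ha b = ∫ j, b j * a j ∂Measure.count := rfl

/-- The functionals given by the rows are pointwise bounded, hence bounded in norm; the `n`-th one
is evaluated at the `n`-th unit sequence. -/
theorem exists_norm_diag_le {a : ℕ → ℕ → ℂ} (ha : ∀ n, Integrable (a n) Measure.count)
    (h : ∀ b : BoundedContinuousFunction ℕ ℂ,
      Tendsto (fun n => ∫ j, b j * a n j ∂Measure.count) atTop (𝓝 0)) :
    ∃ C : ℝ, ∀ n, ‖a n n‖ ≤ C := by
  obtain ⟨C, hC⟩ := banach_steinhaus (g := fun n => seqFunctional (a n) (ha n)) fun b => by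
    obtain ⟨C, hC⟩ := (h b).norm.bddAbove_range
    exact ⟨C, fun n => hC ⟨n, rfl⟩⟩
  refine ⟨C, fun n => ?_⟩
  let b : BoundedContinuousFunction ℕ ℂ :=
    BoundedContinuousFunction.ofNormedAddCommGroupDiscrete (Pi.single n 1) 1 fun j => by
      by_cases hj : j = n
      · subst hj; simp
      · simp [hj]
  have hb : ‖b‖ ≤ 1 := (BoundedContinuousFunction.norm_le zero_le_one).2 fun j => by
    by_cases hj : j = n
    · subst hj; simp [b]
    · simp [b, hj]
  have hval : seqFunctional (a n) (ha n) b = a n n := by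
    rw [seqFunctional_apply, ← setIntegral_eq_integral_of_forall_compl_eq_zero (s := {n})]
    · simp [b]
    · intro j hj
      simp [b, mem_singleton_iff.not.1 hj]
  rw [← hval]
  exact ((seqFunctional (a n) (ha n)).le_of_opNorm_le_of_le (hC n) hb).trans_eq (mul_one C)

/-- The coefficients `2^{-j} e^{-j ω(|ξ_j|)}`. -/
def rapidCoeff (ω : ℝ → ℝ) (ξ : ℕ → EuclideanSpace ℝ (Fin d)) (j : ℕ) : ℝ :=
  (1 / 2) ^ j * Real.exp (-(j * ω ‖ξ j‖))

theorem rapidCoeff_pos (ω : ℝ → ℝ) (ξ : ℕ → EuclideanSpace ℝ (Fin d)) (j : ℕ) :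
    0 < rapidCoeff ω ξ j := by
  unfold rapidCoeff; positivity

/-- As soon as `j ≥ l`, the factor `e^{-j ω(|ξ_j|)}` absorbs the weight and `2^{-j}` remains; no
growth of the frequencies is needed. -/
theorem summable_rapidCoeff_mul_exp (hω : IsWeight ω) (ξ : ℕ → EuclideanSpace ℝ (Fin d))
    (l : ℝ) : Summable fun j => rapidCoeff ω ξ j * Real.exp (l * ω ‖ξ j‖) := by
  refine Summable.of_norm_bounded_eventually_nat summable_geometric_two ?_
  filter_upwards [eventually_ge_atTop ⌈l⌉₊] with j hj
  have hlj : l ≤ j := (Nat.le_ceil l).trans (by exact_mod_cast hj)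
  rw [Real.norm_of_nonneg (mul_pos (rapidCoeff_pos ω ξ j) (Real.exp_pos _)).le, rapidCoeff,
    mul_assoc, ← Real.exp_add]
  refine mul_le_of_le_one_right (by positivity) (Real.exp_le_one_iff.2 ?_)
  nlinarith [mul_nonneg (sub_nonneg.2 hlj) (hω.nonneg_norm (ξ j))]

theorem integrable_rapidCoeff_mul_exp (hω : IsWeight ω) (ξ : ℕ → EuclideanSpace ℝ (Fin d))
    (l : ℝ) :
    Integrable (fun j => rapidCoeff ω ξ j * Real.exp (l * ω ‖ξ j‖)) Measure.count :=
  ⟨measurable_from_nat.aestronglyMeasurable, hasFiniteIntegral_count_iff.2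
    (summable_rapidCoeff_mul_exp hω ξ l).norm⟩

theorem integrable_mul_rapidCoeff (hω : IsWeight ω) (ξ : ℕ → EuclideanSpace ℝ (Fin d))
    {b : ℕ → ℂ} {C : ℝ} (hb : ∀ j, ‖b j‖ ≤ C) :
    Integrable (fun j => b j * rapidCoeff ω ξ j) Measure.count := by
  have h := (integrable_rapidCoeff_mul_exp hω ξ 0).ofReal (𝕜 := ℂ)
  simp only [zero_mul, Real.exp_zero, mul_one] at h
  exact h.bdd_mul measurable_from_nat.aestronglyMeasurable (Eventually.of_forall hb)

theorem mul_superposition_mem_testFun (hω : IsWeight ω)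
    {φ : EuclideanSpace ℝ (Fin d) → ℂ} (hφ : φ ∈ testFun ω Ω)
    (ξ : ℕ → EuclideanSpace ℝ (Fin d)) (b : BoundedContinuousFunction ℕ ℂ) :
    (fun x => φ x * superposition Measure.count ξ (fun j => b j * rapidCoeff ω ξ j) x) ∈
      testFun ω Ω := by
  have hm := integrable_mul_rapidCoeff hω ξ b.norm_coe_le_norm
  have hξ : Measurable ξ := measurable_from_nat
  refine ⟨hφ.1.mul (continuous_superposition hξ hm), hφ.2.1.mul_right,
    (tsupport_mul_subset_left).trans hφ.2.2.1, fun l hl => ?_⟩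
  refine (fourierNorm_mul_superposition_le hω hl.le hξ hm
    (integrable_of_mem_testFun hφ)).trans_lt (ENNReal.mul_lt_top (hφ.2.2.2 l hl) ?_)
  refine lt_of_le_of_lt ?_ ((integrable_rapidCoeff_mul_exp hω ξ l).const_mul ‖b‖).2
  refine lintegral_mono fun j => ?_
  dsimp only
  rw [enorm_mul, enorm_mul, enorm_mul, ← ofReal_norm (Real.exp _),
    Real.norm_of_nonneg (Real.exp_pos _).le, ← mul_assoc]
  gcongr
  · rw [← ofReal_norm, ← ofReal_norm, norm_norm]
    exact ENNReal.ofReal_le_ofReal (b.norm_coe_le_norm j)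
  · simp [← ofReal_norm]

theorem norm_fourier_le (f : EuclideanSpace ℝ (Fin d) → ℂ) (ξ : EuclideanSpace ℝ (Fin d)) :
    ‖𝓕 f ξ‖ ≤ ∫ x, ‖f x‖ :=
  VectorFourier.norm_fourierIntegral_le_integral_norm _ _ _ _ _

theorem tendsto_of_mem_negligibleConst {c : Ioo (0 : ℝ) 1 → ℂ} (hc : c ∈ negligibleConst ω)
    {k : ℝ} (hk : 0 < k) :
    Tendsto (fun ε : Ioo (0 : ℝ) 1 => (Real.exp (k * ω (1 / (ε : ℝ))) : ℂ) * c ε)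
      epsZero (𝓝 0) := by
  have h := (ENNReal.tendsto_toReal ENNReal.zero_ne_top).comp (hc k hk)
  rw [tendsto_zero_iff_norm_tendsto_zero]
  refine h.congr fun ε => ?_
  simp [Real.exp_nonneg, Complex.norm_real, mul_comm, -Complex.ofReal_exp]

/-- If all pairings of `(u_ε)` with test functions are negligible then the Fourier transforms of
`φ u_ε` are small, uniformly up to a weight. -/
theorem exists_norm_fourier_le (hω : IsWeight ω) {φ : EuclideanSpace ℝ (Fin d) → ℂ}
    (hφ : φ ∈ testFun ω Ω) {u : Net Ω} (hu : ∀ ε, u ε ∈ ultraDiff ω Ω)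
    (hpair : ∀ ρ ∈ testFun ω Ω, (fun ε => pairing Ω (u ε) ρ) ∈ negligibleConst ω)
    {k : ℝ} (hk : 0 < k) :
    ∃ n : ℕ, ∀ ε : Ioo (0 : ℝ) 1, (ε : ℝ) < 1 / (n + 1) → ∀ ξ : EuclideanSpace ℝ (Fin d),
      Real.exp (k * ω (1 / (ε : ℝ))) * ‖𝓕 (fun x => φ x * zeroExt Ω (u ε) x) ξ‖ ≤
        n * 2 ^ n * Real.exp (n * ω ‖ξ‖) := by
  by_contra! hne
  -- The points where the bound fails for each `n` supply the frequencies of the character series.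
  choose e he ξ hξ using hne
  have hv (ε) : Integrable fun x => φ x * zeroExt Ω (u ε) x :=
    integrable_of_mem_testFun ((hu ε).2 φ hφ)
  have he0 : Tendsto e atTop epsZero := by
    refine tendsto_comap_iff.2 (tendsto_nhdsWithin_iff.2
      ⟨?_, Eventually.of_forall fun n => (e n).2.1⟩)
    exact tendsto_of_tendsto_of_tendsto_of_le_of_le tendsto_const_nhds
      tendsto_one_div_add_atTop_nhds_zero_nat (fun n => (e n).2.1.le) fun n => (he n).le
  let V : ℕ → EuclideanSpace ℝ (Fin d) → ℂ := fun n => 𝓕 fun x => φ x * zeroExt Ω (u (e n)) x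
  let a : ℕ → ℕ → ℂ := fun n j =>
    (Real.exp (k * ω (1 / (e n : ℝ))) : ℂ) * (V n (ξ j) * rapidCoeff ω ξ j)
  have ha (n) : Integrable (a n) Measure.count :=
    (integrable_mul_rapidCoeff hω ξ fun j => norm_fourier_le _ (ξ j)).const_mul _
  obtain ⟨C, hC⟩ := exists_norm_diag_le ha fun b => by
    have h := (tendsto_of_mem_negligibleConst
      (hpair _ (mul_superposition_mem_testFun hω hφ ξ b)) hk).comp he0
    refine h.congr fun n => ?_
    have hS := integral_mul_superposition (ν := Measure.count) (ξ := ξ) measurable_from_nat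
      (integrable_mul_rapidCoeff hω ξ b.norm_coe_le_norm) (hv (e n))
    rw [Function.comp_apply, pairing_eq]
    simp only [mul_right_comm (φ _), hS, a, ← integral_const_mul]
    refine integral_congr_ae (Eventually.of_forall fun j => ?_)
    simp only [V]
    ring
  obtain ⟨n, hn⟩ := exists_nat_gt C
  have h1 := hC n
  have h2 := mul_lt_mul_of_pos_right (hξ n) (rapidCoeff_pos ω ξ n)
  have h3 : ‖a n n‖ = Real.exp (k * ω (1 / (e n : ℝ))) * ‖V n (ξ n)‖ * rapidCoeff ω ξ n := by
    simp only [a, norm_mul, Complex.norm_real, Real.norm_of_nonneg (Real.exp_pos _).le,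
      Real.norm_of_nonneg (rapidCoeff_pos ω ξ n).le, mul_assoc]
  -- The claimed bound is exactly `n` divided by the coefficient, so its failure makes the diagonal
  -- entries exceed every constant.
  have h4 : (n : ℝ) * 2 ^ n * Real.exp (n * ω ‖ξ n‖) * rapidCoeff ω ξ n = n := by
    rw [rapidCoeff, Real.exp_neg]
    field_simp
    simp
  rw [h4, ← h3] at h2
  linarith

end UniformBoundedness
-- Splitting low and high frequencies
section Interpolation

/-- Up to an additive constant `ω(t)` dominates `log (1 + t)`, so `p = d + 1` compares the integrand
with `(1 + |ξ|)^{-(d+1)}`. -/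
theorem IsWeight.exists_lintegral_exp_lt_top (hω : IsWeight ω) :
    ∃ p : ℝ, 0 < p ∧
      ∫⁻ ξ : EuclideanSpace ℝ (Fin d), ENNReal.ofReal (Real.exp (-(p * ω ‖ξ‖))) < ∞ := by
  obtain ⟨T, hT0, hT⟩ := (hω.eventually_log_le.and (eventually_ge_atTop 0)).exists_forall_of_atTop
    |>.imp fun T hT => (⟨(hT T le_rfl).2, fun t ht => (hT t ht).1⟩ :
      0 ≤ T ∧ ∀ t, T ≤ t → Real.log (1 + t) ≤ ω t)
  have hlog (t : ℝ) (ht : 0 ≤ t) : Real.log (1 + t) ≤ ω t + Real.log (1 + T) := by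
    rcases le_total T t with h | h
    · exact (hT t h).trans (le_add_of_nonneg_right (Real.log_nonneg (by linarith)))
    · exact (Real.log_le_log (by linarith) (by linarith)).trans
        (le_add_of_nonneg_left (hω.nonneg t ht))
  have hp : (0 : ℝ) < d + 1 := by positivity
  refine ⟨d + 1, hp, ?_⟩
  have hI := finite_integral_one_add_norm (E := EuclideanSpace ℝ (Fin d)) (μ := volume)
    (r := d + 1) (by simp)
  refine lt_of_le_of_lt ?_ (ENNReal.mul_lt_top
    (ENNReal.ofReal_lt_top (r := Real.exp ((d + 1) * Real.log (1 + T)))) hI)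
  rw [← lintegral_const_mul' _ _ ENNReal.ofReal_ne_top]
  refine lintegral_mono fun ξ => ?_
  rw [← ENNReal.ofReal_mul (Real.exp_pos _).le, Real.rpow_def_of_pos (by positivity),
    ← Real.exp_add]
  gcongr
  nlinarith [mul_le_mul_of_nonneg_left (hlog ‖ξ‖ (norm_nonneg ξ)) hp.le]

/-- Here `t = ω(|ξ|)`, `W = ω(1/ε)` and `a = |V_ε(ξ)|`. If `M t ≤ W`, one of the two spare factors
`e^{-W}` pays for `e^{(n+h+p)t}`, and the other stays as decay. If `W ≤ M t`, then `e^{(k₀+k)W}` is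
at most `e^{M(k₀+k)t}`. -/
theorem interpolation_le {a t W h k k₀ M p K A : ℝ} {n : ℕ} (ha : 0 ≤ a)
    (hM : M = n + h + p) (hK : K = k + 2) (hk : 0 ≤ k₀ + k)
    (hA : 0 ≤ A) (hbound : Real.exp (K * W) * a ≤ A * Real.exp (n * t)) :
    a * Real.exp (h * t) * Real.exp (k * W) ≤
      a * Real.exp ((h + M * (k₀ + k)) * t) * Real.exp (-(k₀ * W)) +
        A * Real.exp (-(p * t)) * Real.exp (-W) := by
  rcases le_total (M * t) W with hle | hle
  · refine le_add_of_nonneg_of_le (by positivity) ?_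
    calc a * Real.exp (h * t) * Real.exp (k * W)
        = Real.exp (K * W) * a * Real.exp (h * t - 2 * W) := by
          rw [mul_assoc, mul_comm _ a, mul_assoc, ← Real.exp_add, ← Real.exp_add, hK]
          ring_nf
      _ ≤ A * Real.exp (n * t) * Real.exp (h * t - 2 * W) := by gcongr
      _ ≤ _ := by
          rw [mul_assoc, mul_assoc, ← Real.exp_add, ← Real.exp_add]
          refine mul_le_mul_of_nonneg_left (Real.exp_le_exp.2 ?_) hA
          subst hM
          linarith
  · refine le_add_of_le_of_nonneg ?_ (by positivity)
    rw [mul_assoc, mul_assoc, ← Real.exp_add, ← Real.exp_add]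
    refine mul_le_mul_of_nonneg_left (Real.exp_le_exp.2 ?_) ha
    nlinarith [mul_le_mul_of_nonneg_left hle hk]

theorem isLittleOExp_of_regular (hω : IsWeight ω) {φ : EuclideanSpace ℝ (Fin d) → ℂ}
    (hφ : φ ∈ testFun ω Ω) {u : Net Ω} (hu : ∀ ε, u ε ∈ ultraDiff ω Ω)
    (hpair : ∀ ρ ∈ testFun ω Ω, (fun ε => pairing Ω (u ε) ρ) ∈ negligibleConst ω)
    {k₀ : ℝ} (hk₀ : 0 < k₀) (hreg : ∀ h : ℝ, 0 < h →
      IsLittleOExp ω k₀ fun ε => fourierNorm ω h (fun x => φ x * zeroExt Ω (u ε) x))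
    {h k : ℝ} (hh : 0 < h) (hk : 0 < k) :
    IsLittleOExp ω (-k) fun ε => fourierNorm ω h (fun x => φ x * zeroExt Ω (u ε) x) := by
  obtain ⟨p, hp, hI⟩ := hω.exists_lintegral_exp_lt_top (d := d)
  obtain ⟨n, hn⟩ := exists_norm_fourier_le hω hφ hu hpair (k := k + 2) (by linarith)
  set I := ∫⁻ ξ : EuclideanSpace ℝ (Fin d), ENNReal.ofReal (Real.exp (-(p * ω ‖ξ‖)))
  set M : ℝ := n + h + p
  set A : ℝ := n * 2 ^ n
  have hM : 0 < M := by positivity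
  have hA : 0 ≤ A := by positivity
  have hW : Tendsto (fun ε : Ioo (0 : ℝ) 1 => ENNReal.ofReal (Real.exp (-ω (1 / (ε : ℝ)))))
      epsZero (𝓝 0) := by
    rw [← ENNReal.ofReal_zero]
    exact ENNReal.tendsto_ofReal (Real.tendsto_exp_neg_atTop_nhds_zero.comp
      (hω.tendsto_atTop.comp tendsto_one_div_epsZero))
  -- Regularity enters here: `M` depends on `n`, hence on `k`, yet the exponent `k₀` is unchanged at
  -- this larger weight.
  have hlim := Tendsto.add (hreg (h + M * (k₀ + k)) (by positivity))
    (ENNReal.Tendsto.const_mul (a := ENNReal.ofReal A * I) hW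
      (Or.inr (ENNReal.mul_lt_top ENNReal.ofReal_lt_top hI).ne))
  rw [mul_zero, add_zero] at hlim
  refine tendsto_of_tendsto_of_tendsto_of_le_of_le' tendsto_const_nhds hlim
    (Eventually.of_forall fun _ => zero_le) ?_
  filter_upwards [eventually_lt_epsZero (δ := 1 / (n + 1)) (by positivity)] with ε hε
  have hV : Measurable (𝓕 fun x => φ x * zeroExt Ω (u ε) x) :=
    (continuous_fourier (integrable_of_mem_testFun ((hu ε).2 φ hφ))).measurable
  have hmeas : Measurable fun ξ => ‖𝓕 (fun x => φ x * zeroExt Ω (u ε) x) ξ‖ₑ *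
      ENNReal.ofReal (Real.exp ((h + M * (k₀ + k)) * ω ‖ξ‖)) *
      ENNReal.ofReal (Real.exp (-(k₀ * ω (1 / (ε : ℝ))))) :=
    (hV.enorm.mul (hω.measurable_exp _)).mul_const _
  simp only [fourierNorm, I, neg_mul, neg_neg]
  rw [← lintegral_mul_const' _ _ ENNReal.ofReal_ne_top,
    ← lintegral_mul_const' _ _ ENNReal.ofReal_ne_top,
    ← lintegral_const_mul' _ _ ENNReal.ofReal_ne_top,
    ← lintegral_mul_const' _ _ ENNReal.ofReal_ne_top,
    ← lintegral_add_left hmeas]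
  refine lintegral_mono fun ξ => ?_
  simp only [← ofReal_norm]
  repeat rw [← ENNReal.ofReal_mul (by positivity)]
  rw [← ENNReal.ofReal_add (by positivity) (by positivity)]
  exact ENNReal.ofReal_le_ofReal (interpolation_le (norm_nonneg _) rfl rfl (by positivity) hA
    (hn ε hε ξ))

theorem negligible_of_regular (hω : IsWeight ω) {u : Net Ω} (hu : u ∈ regularNets ω Ω)
    (hpair : ∀ ρ ∈ testFun ω Ω, (fun ε => pairing Ω (u ε) ρ) ∈ negligibleConst ω) :
    u ∈ negligibleNets ω Ω := by
  refine ⟨hu.1.1, fun K hK hKΩ h hh k hk => ?_⟩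
  obtain ⟨φ, hφ, hφK⟩ := exists_cutoff hu.1 hK hKΩ
  obtain ⟨k₀, hk₀, hreg⟩ := hu.2 _ hφ.2.1 hφ.2.2.1
  exact localNorm_isLittleOExp hφ hφK (isLittleOExp_of_regular hω hφ hu.1.1 hpair hk₀
    (fun l hl => fourierNorm_isLittleOExp hω hφ hu.1.1 hl (hreg l hl)) hh hk)

end Interpolation

/-! ### Passage to cosets -/

theorem zero_mem_negligibleNets (hω : IsWeight ω) {u : Net Ω} (hu : u ∈ negligibleNets ω Ω) :
    (0 : Net Ω) ∈ negligibleNets ω Ω := by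
  simpa using sub_mem_negligibleNets hω hu hu

theorem genClass_eq_genClass_zero (hω : IsWeight ω) {u : Net Ω}
    (hu : u ∈ negligibleNets ω Ω) : genClass ω Ω u = genClass ω Ω 0 := by
  have hneg : -u ∈ negligibleNets ω Ω := by
    simpa using sub_mem_negligibleNets hω (zero_mem_negligibleNets hω hu) hu
  ext v
  simp only [genClass, mem_ofPred_eq, sub_zero]
  refine and_congr_right fun _ => ⟨fun hv => ?_, fun hv => sub_mem_negligibleNets hω hv hu⟩
  simpa using sub_mem_negligibleNets hω hv hneg

end BeurlingBjork

end

theorem mainTheorem10 {d : ℕ} {ω : ℝ → ℝ} (hω : BeurlingBjork.IsWeight ω)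
    (Ω : TopologicalSpace.Opens (EuclideanSpace ℝ (Fin d)))
    (g : Set (BeurlingBjork.Net Ω)) (hg : g ∈ BeurlingBjork.regularGenFun ω Ω)
    (gε : BeurlingBjork.Net Ω) (hgε : gε ∈ g)
    (hpair : ∀ ρ ∈ BeurlingBjork.testFun ω Ω,
      (fun ε => BeurlingBjork.pairing Ω (gε ε) ρ) ∈ BeurlingBjork.negligibleConst ω) :
    g = BeurlingBjork.genClass ω Ω 0 := by
  obtain ⟨⟨g₀, -, rfl⟩, u, hu, hreg⟩ := hg
  have hdiff : gε - u ∈ BeurlingBjork.negligibleNets ω Ω := by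
    simpa using BeurlingBjork.sub_mem_negligibleNets hω hgε.2 hu.2
  have hneg : u ∈ BeurlingBjork.negligibleNets ω Ω := by
    refine BeurlingBjork.negligible_of_regular hω hreg fun ρ hρ => ?_
    -- The pairing with `u` is the pairing with `gε` minus the pairing with the negligible net `gε -
    -- u`.
    have h := BeurlingBjork.sub_mem_negligibleConst (hpair ρ hρ)
      (BeurlingBjork.pairing_mem_negligibleConst hω hdiff hρ)
    refine (funext fun ε => ?_ : (fun ε => BeurlingBjork.pairing Ω (u ε) ρ) = _) ▸ h
    rw [Pi.sub_apply, BeurlingBjork.pairing_sub hρ (hgε.1.1 ε) (hreg.1.1 ε), sub_sub_cancel]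
  have hg₀ : g₀ ∈ BeurlingBjork.negligibleNets ω Ω := by
    simpa using BeurlingBjork.sub_mem_negligibleNets hω hneg hu.2
  exact BeurlingBjork.genClass_eq_genClass_zero hω hg₀
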